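/- Let $d\ge 1$, let $\nu\neq 0$ be a Lévy measure on $\mathbb{R}^d$ (a positive Borel measure with $\nu(\{0\})=0$ and $\int(1\wedge\|u\|_2^2)\,\nu(du)<\infty$), let $\gamma\in\mathbb{R}^d$, and let $X=(X_1,\dots,X_d)\sim ID(\gamma,0,\nu)$, i.e. $X$ is a random vector with characteristic function $$\mathbb{E}e^{i\langle t,X\rangle}=\exp\Big\{i\langle t,\gamma\rangle+\int_{\mathbb{R}^d}\big(e^{i\langle t,u\rangle}-1-i\langle t,u\rangle\mathbf 1_{\|u\|_2\le 1}\big)\,\nu(du)\Big\},\qquad t\in\mathbb{R}^d.$$ Assume that the components $X_1,\dots,X_d$ are independent; then $\nu$ is carried by the coordinate axes, and for $1\le k\le d$ let $\tilde\nu_k(B)=\nu(\{b\,e_k: b\in B\})$ be the one-dimensional Lévy measure on the $k$-th axis. Assume that $R_k=\inf\{\rho>0:\tilde\nu_k(|u|>\rho)=0\}$ is finite for every $k$ (with $\inf\emptyset=+\infty$), and put $R=\max_{1\le k\le d}R_k$. Let $\varepsilon>0$. Then $0<\mathbb{E}\|X\|_2<\infty$, all $\int u^2\,\tilde\nu_k(du)$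 and $\int u^4\,\tilde\nu_k(du)$ are finite, and with $$V_\varepsilon^2=8\max_{1\le k\le d}\int u^2\,\tilde\nu_k(du)+\frac{2}{(\varepsilon\,\mathbb{E}\|X\|_2)^2}\sum_{k=1}^d\int u^4\,\tilde\nu_k(du)$$ one has, for all $x\ge 0$, $$\mathbb{P}\big(\|X\|_2\ge(1+\varepsilon)\mathbb{E}\|X\|_2+x\big)\le\exp\Big(\frac{x}{R}-\Big(\frac{x}{R}+\frac{V_\varepsilon^2}{R^2}\Big)\log\Big(1+\frac{Rx}{V_\varepsilon^2}\Big)\Big).$$ -/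

import Mathlib

open MeasureTheory ProbabilityTheory
open scoped ENNReal RealInnerProductSpace

noncomputable section

/-- Lévy measures on `ℝ^d` (with the Euclidean norm): Borel measures without atom at the origin
that integrate `1 ∧ ‖u‖²`. -/
structure IsLevyMeasure {d : ℕ} (ν : Measure (EuclideanSpace ℝ (Fin d))) : Prop where
  no_atom : ν {0} = 0
  lintegral_lt_top : ∫⁻ u, ENNReal.ofReal (min 1 (‖u‖ ^ 2)) ∂ν < ∞

/-- The Lévy exponent with drift `γ`, no Gaussian component and Lévy measure `ν`:
`i⟨t, γ⟩ + ∫ (e^{i⟨t, u⟩} - 1 - i⟨t, u⟩ 1_{‖u‖ ≤ 1}) ν(du)`. -/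
def levyExponent {d : ℕ} (γ : EuclideanSpace ℝ (Fin d))
    (ν : Measure (EuclideanSpace ℝ (Fin d))) (t : EuclideanSpace ℝ (Fin d)) : ℂ :=
  Complex.I * ((⟪t, γ⟫ : ℝ) : ℂ) +
    ∫ u, (Complex.exp (Complex.I * ((⟪t, u⟫ : ℝ) : ℂ)) - 1
      - Complex.I * ((if ‖u‖ ≤ 1 then ⟪t, u⟫ else 0 : ℝ) : ℂ)) ∂ν

/-- `X ∼ ID(γ, 0, ν)` under `P`: `X` is an infinitely divisible random vector of `ℝ^d` without
Gaussian component, with Lévy measure `ν` and characteristic function `exp (levyExponent γ ν)`. -/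
structure IsIDVector {d : ℕ} {Ω : Type*} [MeasurableSpace Ω] (X : Ω → EuclideanSpace ℝ (Fin d))
    (γ : EuclideanSpace ℝ (Fin d)) (ν : Measure (EuclideanSpace ℝ (Fin d)))
    (P : Measure Ω) : Prop where
  measurable : Measurable X
  isLevyMeasure : IsLevyMeasure ν
  charFun_eq : ∀ t, charFun (P.map X) t = Complex.exp (levyExponent γ ν t)

/-- The `k`-th one-dimensional Lévy measure `ν̃_k` of `ν`, i.e. the part of `ν` carried by the
`k`-th coordinate axis, `ν̃_k(B) = ν {b e_k : b ∈ B}`. When `ν` is carried by the axes,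
`ν(dx) = ∑ₖ δ₀(dx₁) ⋯ ν̃_k(dx_k) ⋯ δ₀(dx_d)`. -/
def axisLevyMeasure {d : ℕ} (ν : Measure (EuclideanSpace ℝ (Fin d))) (k : Fin d) : Measure ℝ :=
  (ν.restrict {u | ∀ j, j ≠ k → u j = 0}).map (fun u => u k)

/-- `inf {ρ > 0 : μ(|u| > ρ) = 0}`, with value `∞` when there is no such `ρ`. -/
def supportRadius (μ : Measure ℝ) : ℝ≥0∞ :=
  sInf (ENNReal.ofReal '' {ρ : ℝ | 0 < ρ ∧ μ {u | ρ < |u|} = 0})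

/-- `R = max_k R_k`, where `R_k` is the support radius of `ν̃_k`. -/
def maxRadius {d : ℕ} (ν : Measure (EuclideanSpace ℝ (Fin d))) : ℝ :=
  (⨆ k, supportRadius (axisLevyMeasure ν k)).toReal

/-- `V² = 8 max_k ∫ u² ν̃_k(du) + (2 / (ε m)²) ∑ₖ ∫ u⁴ ν̃_k(du)`, to be used with
`m = 𝔼‖X‖₂`. -/
def varianceFactor {d : ℕ} (ν : Measure (EuclideanSpace ℝ (Fin d))) (ε m : ℝ) : ℝ :=
  8 * (⨆ k, ∫ u, u ^ 2 ∂(axisLevyMeasure ν k)) +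
    2 / (ε * m) ^ 2 * ∑ k, ∫ u, u ^ 4 ∂(axisLevyMeasure ν k)

end

/-! If jumps along `ν` change `g` by at most `R`, and by at most `√W` in `L²(ν)` from every base
point, then `g(X)` has a Poisson-type exponential moment (`IsIDVector.integral_exp_le`). For a lazy
random walk this follows by induction on the number of steps, because averaging over one step
preserves both increment bounds (`IncrBound.average`). Removing the small jumps and refining the
walk gives laws that converge weakly to that of `X`, and the estimate does not depend on the
approximation.

Independence makes the real part of the Lévy exponent additive across coordinates, so almost every
jump is parallel to an axis (`IsIDVector.ae_eq_zero_or_eq_zero`). A jump `v e_k` changes `‖x‖²` by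
`2 v x_k + v²`. Once the norm is bounded below by `ε 𝔼‖X‖`, dividing by it turns this into an
increment bound with `W = V_ε²`: the weights `x_k²/‖x‖²` sum to at most one, which produces a
maximum over `k` rather than a sum (`IsLevyMeasure.incrBound_clippedNorm`). The floor raises the
mean by at most `ε 𝔼‖X‖`, whence the factor `1 + ε`. Chernoff's inequality concludes. -/

/-! ### Elementary exponential inequalities. -/

/-- The function `(exp y - 1 - y) / y ^ 2` is largest, on `[-z, z]`, at `z`. -/
theorem exp_sub_one_sub_le {y z : ℝ} (hz : 0 < z) (hy : |y| ≤ z) :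
    Real.exp y - 1 - y ≤ y ^ 2 / z ^ 2 * (Real.exp z - 1 - z) := by
  have key : ∀ w : ℝ, HasSum (fun n : ℕ => w ^ (n + 2) / ((n + 2).factorial : ℝ))
      (Real.exp w - 1 - w) := by
    intro w
    have h := NormedSpace.expSeries_div_hasSum_exp (𝔸 := ℝ) w
    rw [← Real.exp_eq_exp_ℝ] at h
    have h2 := (hasSum_nat_add_iff' (f := fun n : ℕ => w ^ n / (n.factorial : ℝ)) 2).2 h
    simpa [Finset.sum_range_succ, sub_sub] using h2
  -- After factoring out `y²`, the series are compared term by term through `y ^ n ≤ z ^ n`.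
  refine hasSum_le (fun n => ?_) (key y) ((key z).mul_left (y ^ 2 / z ^ 2))
  have h1 : y ^ n ≤ z ^ n := by
    calc y ^ n ≤ |y ^ n| := le_abs_self _
      _ = |y| ^ n := abs_pow _ _
      _ ≤ z ^ n := by gcongr
  have h2 : y ^ 2 / z ^ 2 * (z ^ (n + 2) / ((n + 2).factorial : ℝ))
      = y ^ 2 * z ^ n / ((n + 2).factorial : ℝ) := by
    field_simp
    ring
  rw [h2, pow_add, mul_comm]
  gcongr

theorem exp_mul_sub_one_sub_le {l D R : ℝ} (hl : 0 ≤ l) (hR : 0 < R) (hD : |D| ≤ R) :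
    Real.exp (l * D) - 1 - l * D ≤ D ^ 2 * ((Real.exp (l * R) - 1 - l * R) / R ^ 2) := by
  rcases hl.eq_or_lt with rfl | hl
  · simp
  · have h := exp_sub_one_sub_le (y := l * D) (z := l * R) (by positivity)
      (by rw [abs_mul, abs_of_pos hl]; gcongr)
    refine h.trans_eq ?_
    field_simp

theorem exp_sub_one_sub_nonneg (y : ℝ) : 0 ≤ Real.exp y - 1 - y := by
  linarith [Real.add_one_le_exp y]

/-! ### Exponential moments along lazy random walks. -/

section Steps

variable {E : Type*} [NormedAddCommGroup E] [MeasurableSpace E] [BorelSpace E]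
  [SecondCountableTopology E]

/-- Bounded measurable functions whose increments along `ν` are at most `R`, and at most `√W` in
`L²(ν)`. -/
structure IncrBound (ν : Measure E) (R W : ℝ) (g : E → ℝ) : Prop where
  measurable : Measurable g
  bounded : ∃ C, ∀ x, |g x| ≤ C
  abs_le : ∀ᵐ u ∂ν, ∀ x, |g (x + u) - g x| ≤ R
  lintegral_le : ∀ x, ∫⁻ u, ENNReal.ofReal ((g (x + u) - g x) ^ 2) ∂ν ≤ ENNReal.ofReal W

/-- The law that jumps according to `ν` with probability `ν univ / n`, and otherwise stays put. -/
noncomputable def lazyStep (ν : Measure E) (n : ℕ) : Measure E :=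
  ENNReal.ofReal (1 - ν.real Set.univ / n) • Measure.dirac 0 + ENNReal.ofReal (n : ℝ)⁻¹ • ν

/-- The law after `n` independent steps of law `ρ`, starting from `a`. -/
noncomputable def walkLaw (a : E) (ρ : Measure E) : ℕ → Measure E
  | 0 => Measure.dirac a
  | n + 1 => walkLaw a ρ n ∗ ρ

theorem isProbabilityMeasure_lazyStep {E : Type*} [NormedAddCommGroup E] [MeasurableSpace E]
    (ν : Measure E) [IsFiniteMeasure ν] {n : ℕ} (hn : 0 < n) (h : ν.real Set.univ ≤ n) :
    IsProbabilityMeasure (lazyStep ν n) := by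
  have hn' : (0 : ℝ) < n := by exact_mod_cast hn
  constructor
  have h0 : 0 ≤ 1 - ν.real Set.univ / n := by
    rw [sub_nonneg, div_le_one hn']; exact h
  rw [lazyStep]
  simp only [Measure.coe_add, Measure.coe_smul, Pi.add_apply, Pi.smul_apply, measure_univ,
    smul_eq_mul, mul_one]
  rw [← ofReal_measureReal (measure_ne_top ν Set.univ), ← ENNReal.ofReal_mul (by positivity),
    ← ENNReal.ofReal_add h0 (by positivity)]
  rw [ENNReal.ofReal_eq_one]
  field_simp
  ring

instance isProbabilityMeasure_walkLaw (a : E) (ρ : Measure E) [IsProbabilityMeasure ρ] (n : ℕ) :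
    IsProbabilityMeasure (walkLaw a ρ n) := by
  induction n with
  | zero => rw [walkLaw]; infer_instance
  | succ n ih => rw [walkLaw]; infer_instance

theorem integral_lazyStep {F : Type*} [NormedAddCommGroup F] [NormedSpace ℝ F] [CompleteSpace F]
    (ν : Measure E) [IsFiniteMeasure ν] {n : ℕ} (hn : 0 < n)
    (h : ν.real Set.univ ≤ n) {g : E → F} (hg : Integrable g ν) :
    ∫ u, g u ∂(lazyStep ν n) = g 0 + (n : ℝ)⁻¹ • ∫ u, (g u - g 0) ∂ν := by
  have hn' : (0 : ℝ) < n := by exact_mod_cast hn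
  have h0 : 0 ≤ 1 - ν.real Set.univ / n := by
    rw [sub_nonneg, div_le_one hn']; exact h
  rw [lazyStep, integral_add_measure, integral_smul_measure, integral_smul_measure,
    integral_dirac, integral_sub hg (integrable_const _), integral_const,
    ENNReal.toReal_ofReal h0, ENNReal.toReal_ofReal (by positivity)]
  · rw [smul_sub, smul_smul, sub_smul, one_smul, div_eq_inv_mul]
    abel
  · exact (integrable_dirac (by simp)).smul_measure ENNReal.ofReal_ne_top
  · exact hg.smul_measure ENNReal.ofReal_ne_top

theorem integrable_of_abs_le {α : Type*} [MeasurableSpace α] {μ : Measure α} [IsFiniteMeasure μ]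
    {g : α → ℝ} (hg : Measurable g) {C : ℝ} (hC : ∀ x, |g x| ≤ C) : Integrable g μ :=
  Integrable.of_bound hg.aestronglyMeasurable C (.of_forall hC)

/-- One step of the exponential moment bound. -/
theorem integral_exp_lazyStep_le {ν : Measure E} [IsFiniteMeasure ν] {n : ℕ} (hn : 0 < n)
    (h : ν.real Set.univ ≤ n) {R W : ℝ} (hR : 0 < R) (hW : 0 ≤ W) {g : E → ℝ}
    (hg : IncrBound ν R W g) {l : ℝ} (hl : 0 ≤ l) (x : E) :
    ∫ u, Real.exp (l * g (x + u)) ∂(lazyStep ν n) ≤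
      Real.exp (l * ∫ u, g (x + u) ∂(lazyStep ν n) +
        (n : ℝ)⁻¹ * (W * ((Real.exp (l * R) - 1 - l * R) / R ^ 2))) := by
  have hn' : (0 : ℝ) < n := by exact_mod_cast hn
  obtain ⟨C, hC⟩ := hg.bounded
  have hgm := hg.measurable
  have hm : Measurable fun u => g (x + u) := hg.measurable.comp (measurable_const_add x)
  have hi1 : Integrable (fun u => g (x + u)) ν := integrable_of_abs_le hm (fun u => hC _)
  have hexp : ∀ y : E, |Real.exp (l * g y)| ≤ Real.exp (l * C) := fun y => by
    rw [Real.abs_exp]; gcongr; exact (le_abs_self _).trans (hC _)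
  have hi2 : Integrable (fun u => Real.exp (l * g (x + u))) ν :=
    integrable_of_abs_le (by fun_prop) (fun u => hexp _)
  rw [integral_lazyStep ν hn h hi1, integral_lazyStep ν hn h hi2]
  simp only [add_zero, smul_eq_mul]
  set K := (Real.exp (l * R) - 1 - l * R) / R ^ 2 with hK
  have hK0 : 0 ≤ K := div_nonneg (exp_sub_one_sub_nonneg _) (by positivity)
  have hid : Integrable (fun u => g (x + u) - g x) ν := hi1.sub (integrable_const _)
  have hsqb : ∀ u, |(g (x + u) - g x) ^ 2| ≤ (C + C) ^ 2 := fun u => by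
    rw [abs_pow]
    gcongr
    exact (abs_sub _ _).trans (add_le_add (hC _) (hC _))
  have hisq : Integrable (fun u => (g (x + u) - g x) ^ 2) ν :=
    integrable_of_abs_le (by fun_prop) hsqb
  have hsq : ∫ u, (g (x + u) - g x) ^ 2 ∂ν ≤ W := by
    rw [← ENNReal.ofReal_le_ofReal_iff hW,
      ofReal_integral_eq_lintegral_ofReal hisq (.of_forall fun u => sq_nonneg _)]
    exact hg.lintegral_le x
  have e1 : ∫ u, (Real.exp (l * g (x + u)) - Real.exp (l * g x)) ∂ν
      = Real.exp (l * g x) * ∫ u, (Real.exp (l * (g (x + u) - g x)) - 1) ∂ν := by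
    rw [← integral_const_mul]
    congr 1 with u
    rw [mul_sub, mul_one, ← Real.exp_add]
    ring_nf
  have hid2 : Integrable (fun u => Real.exp (l * (g (x + u) - g x)) - 1) ν := by
    refine Integrable.sub ?_ (integrable_const _)
    refine integrable_of_abs_le (C := Real.exp (l * (C + C))) (by fun_prop) (fun u => ?_)
    rw [Real.abs_exp]
    gcongr
    exact (le_abs_self _).trans ((abs_sub _ _).trans (add_le_add (hC _) (hC _)))
  have e2 : ∫ u, (Real.exp (l * (g (x + u) - g x)) - 1) ∂ν
      ≤ l * ∫ u, (g (x + u) - g x) ∂ν + W * K := by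
    calc ∫ u, (Real.exp (l * (g (x + u) - g x)) - 1) ∂ν
        ≤ ∫ u, (l * (g (x + u) - g x) + (g (x + u) - g x) ^ 2 * K) ∂ν := by
          refine integral_mono_ae hid2 ((hid.const_mul l).add (hisq.mul_const K)) ?_
          filter_upwards [hg.abs_le] with u hu
          have := exp_mul_sub_one_sub_le hl hR (hu x)
          linarith
      _ = l * ∫ u, (g (x + u) - g x) ∂ν + (∫ u, (g (x + u) - g x) ^ 2 ∂ν) * K := by
          rw [integral_add (hid.const_mul l) (hisq.mul_const K), integral_const_mul,
            integral_mul_const]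
      _ ≤ _ := by gcongr
  rw [e1]
  calc Real.exp (l * g x) + (n : ℝ)⁻¹ *
        (Real.exp (l * g x) * ∫ u, (Real.exp (l * (g (x + u) - g x)) - 1) ∂ν)
      = Real.exp (l * g x) *
        ((n : ℝ)⁻¹ * ∫ u, (Real.exp (l * (g (x + u) - g x)) - 1) ∂ν + 1) := by ring
    _ ≤ Real.exp (l * g x) *
        ((n : ℝ)⁻¹ * (l * ∫ u, (g (x + u) - g x) ∂ν + W * K) + 1) := by gcongr
    -- The bound `1 + s ≤ exp s` makes the one-step estimates multiply along the walk.
    _ ≤ Real.exp (l * g x) *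
        Real.exp ((n : ℝ)⁻¹ * (l * ∫ u, (g (x + u) - g x) ∂ν + W * K)) := by
          gcongr; exact Real.add_one_le_exp _
    _ = _ := by rw [← Real.exp_add]; ring_nf

/-- Averaging along an independent step preserves increment bounds. -/
theorem IncrBound.average {ν ρ : Measure E} [SFinite ν] [IsProbabilityMeasure ρ] {R W : ℝ}
    {g : E → ℝ} (hg : IncrBound ν R W g) : IncrBound ν R W (fun x => ∫ y, g (x + y) ∂ρ) := by
  obtain ⟨C, hC⟩ := hg.bounded
  have hgm := hg.measurable
  have hi : ∀ x, Integrable (fun y => g (x + y)) ρ := fun x =>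
    integrable_of_abs_le (by fun_prop) (fun y => hC _)
  have hdiff : ∀ x u, ∫ y, g (x + u + y) ∂ρ - ∫ y, g (x + y) ∂ρ
      = ∫ y, (g (x + y + u) - g (x + y)) ∂ρ := fun x u => by
    rw [← integral_sub (hi _) (hi _)]
    congr 1 with y
    rw [add_right_comm]
  have hbound : ∀ (f : E → ℝ) (B : ℝ), (∀ y, |f y| ≤ B) → |∫ y, f y ∂ρ| ≤ B := fun f B hf => by
    have := norm_integral_le_of_norm_le_const (μ := ρ) (f := f) (.of_forall hf)
    simpa using this
  refine ⟨?_, ⟨C, fun x => hbound _ _ fun y => hC _⟩, ?_, fun x => ?_⟩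
  · have : StronglyMeasurable (Function.uncurry fun x y : E => g (x + y)) :=
      (hgm.comp (measurable_fst.add measurable_snd)).stronglyMeasurable
    exact (this.integral_prod_right (ν := ρ)).measurable
  · filter_upwards [hg.abs_le] with u hu x
    rw [hdiff]
    exact hbound _ _ fun y => hu _
  · have jensen : ∀ u, ENNReal.ofReal ((∫ y, g (x + u + y) ∂ρ - ∫ y, g (x + y) ∂ρ) ^ 2)
        ≤ ∫⁻ y, ENNReal.ofReal ((g (x + y + u) - g (x + y)) ^ 2) ∂ρ := fun u => by
      have hb : ∀ y, |g (x + y + u) - g (x + y)| ≤ C + C := fun y =>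
        (abs_sub _ _).trans (add_le_add (hC _) (hC _))
      have h1 : Integrable (fun y => g (x + y + u) - g (x + y)) ρ :=
        integrable_of_abs_le (by fun_prop) hb
      have h2 : Integrable (fun y => (g (x + y + u) - g (x + y)) ^ 2) ρ :=
        integrable_of_abs_le (C := (C + C) ^ 2) (by fun_prop) fun y => by
          rw [abs_pow]; gcongr; exact hb y
      rw [hdiff, ← ofReal_integral_eq_lintegral_ofReal h2 (.of_forall fun y => sq_nonneg _)]
      refine ENNReal.ofReal_le_ofReal ?_
      exact (even_two.convexOn_pow (𝕜 := ℝ)).map_integral_le (by fun_prop) isClosed_univ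
        (.of_forall fun y => Set.mem_univ _) h1 h2
    calc ∫⁻ u, ENNReal.ofReal ((∫ y, g (x + u + y) ∂ρ - ∫ y, g (x + y) ∂ρ) ^ 2) ∂ν
        ≤ ∫⁻ u, ∫⁻ y, ENNReal.ofReal ((g (x + y + u) - g (x + y)) ^ 2) ∂ρ ∂ν :=
          lintegral_mono jensen
      -- After Tonelli, the inner integral is the hypothesis at base point `x + y`; its uniformity
      -- in the base point is what makes the bound stable.
      _ = ∫⁻ y, ∫⁻ u, ENNReal.ofReal ((g (x + y + u) - g (x + y)) ^ 2) ∂ν ∂ρ :=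
          lintegral_lintegral_swap (by fun_prop)
      _ ≤ ∫⁻ y, ENNReal.ofReal W ∂ρ := lintegral_mono fun y => hg.lintegral_le _
      _ = ENNReal.ofReal W := by simp

theorem integral_conv_of_abs_le {μ ρ : Measure E} [IsProbabilityMeasure μ] [IsProbabilityMeasure ρ]
    {f : E → ℝ} (hf : Measurable f) {C : ℝ} (hC : ∀ x, |f x| ≤ C) :
    ∫ z, f z ∂(μ ∗ ρ) = ∫ x, ∫ y, f (x + y) ∂ρ ∂μ :=
  integral_conv (integrable_of_abs_le hf hC)

/-- The exponential moment bound along a walk. -/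
theorem integral_exp_walkLaw_le {ν : Measure E} [IsFiniteMeasure ν] {n : ℕ} (hn : 0 < n)
    (h : ν.real Set.univ ≤ n) {R W : ℝ} (hR : 0 < R) (hW : 0 ≤ W) {l : ℝ} (hl : 0 ≤ l) (a : E)
    (k : ℕ) {g : E → ℝ} (hg : IncrBound ν R W g) :
    ∫ x, Real.exp (l * g x) ∂(walkLaw a (lazyStep ν n) k) ≤
      Real.exp (l * ∫ x, g x ∂(walkLaw a (lazyStep ν n) k) +
        k * ((n : ℝ)⁻¹ * (W * ((Real.exp (l * R) - 1 - l * R) / R ^ 2)))) := by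
  have := isProbabilityMeasure_lazyStep ν hn h
  induction k generalizing g with
  | zero => simp [walkLaw]
  | succ k ih =>
    obtain ⟨C, hC⟩ := hg.bounded
    have hgm := hg.measurable
    set κ := (n : ℝ)⁻¹ * (W * ((Real.exp (l * R) - 1 - l * R) / R ^ 2))
    have hexp : ∀ y : E, |Real.exp (l * g y)| ≤ Real.exp (l * C) := fun y => by
      rw [Real.abs_exp]; gcongr; exact (le_abs_self _).trans (hC _)
    -- The last step is integrated out, and the induction hypothesis is applied to the averaged
    -- function, which has the same mean under the shorter walk.
    have hT := hg.average (ρ := lazyStep ν n)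
    obtain ⟨C', hC'⟩ := hT.bounded
    have hTm := hT.measurable
    rw [walkLaw, integral_conv_of_abs_le (by fun_prop) hexp, integral_conv_of_abs_le hgm hC]
    calc ∫ x, ∫ y, Real.exp (l * g (x + y)) ∂(lazyStep ν n) ∂(walkLaw a (lazyStep ν n) k)
        ≤ ∫ x, Real.exp (l * ∫ y, g (x + y) ∂(lazyStep ν n)) * Real.exp κ
            ∂(walkLaw a (lazyStep ν n) k) := by
          refine integral_mono_of_nonneg
            (.of_forall fun x => integral_nonneg fun y => (Real.exp_pos _).le) ?_
            (.of_forall fun x => ?_)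
          · refine Integrable.mul_const ?_ _
            refine integrable_of_abs_le (C := Real.exp (l * C')) (by fun_prop) fun x => ?_
            rw [Real.abs_exp]; gcongr; exact (le_abs_self _).trans (hC' _)
          · simp only [← Real.exp_add]
            exact integral_exp_lazyStep_le hn h hR hW hg hl x
      _ = (∫ x, Real.exp (l * ∫ y, g (x + y) ∂(lazyStep ν n)) ∂(walkLaw a (lazyStep ν n) k))
            * Real.exp κ := integral_mul_const _ _
      _ ≤ _ := by
          refine (mul_le_mul_of_nonneg_right (ih hT) (Real.exp_pos _).le).trans_eq ?_
          rw [← Real.exp_add]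
          push_cast
          ring_nf

end Steps

/-! ### Weak approximation of `ID(γ, 0, ν)` by walks. -/

section Exponent

theorem norm_pow_sub_pow_le_of_norm_le_one {a b : ℂ} (ha : ‖a‖ ≤ 1) (hb : ‖b‖ ≤ 1) (n : ℕ) :
    ‖a ^ n - b ^ n‖ ≤ n * ‖a - b‖ := by
  induction n with
  | zero => simp
  | succ n ih =>
    have : a ^ (n + 1) - b ^ (n + 1) = a * (a ^ n - b ^ n) + (a - b) * b ^ n := by ring
    rw [this]
    refine (norm_add_le _ _).trans ?_
    rw [norm_mul, norm_mul, norm_pow]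
    have h1 : ‖a‖ * ‖a ^ n - b ^ n‖ ≤ 1 * (n * ‖a - b‖) := by gcongr
    have h2 : ‖a - b‖ * ‖b‖ ^ n ≤ ‖a - b‖ * 1 := by
      gcongr
      exact pow_le_one₀ (norm_nonneg _) hb
    push_cast
    linarith

/-- Both `1 + w/n` and `exp (w/n)` lie in the unit disc and differ by at most `‖w/n‖²`, so their
`n`-th powers differ by at most `n` times that. An explicit rate is needed because `w` varies with
`n` in the application. -/
theorem norm_one_add_pow_sub_exp_le {w : ℂ} {n : ℕ} (hn : 0 < n) (hw : ‖w‖ ≤ n)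
    (h1 : ‖1 + (n : ℂ)⁻¹ * w‖ ≤ 1) (hre : w.re ≤ 0) :
    ‖(1 + (n : ℂ)⁻¹ * w) ^ n - Complex.exp w‖ ≤ ‖w‖ ^ 2 / n := by
  have hn' : (0 : ℝ) < n := by exact_mod_cast hn
  have hnC : (n : ℂ) ≠ 0 := by exact_mod_cast hn.ne'
  have e : Complex.exp w = Complex.exp ((n : ℂ)⁻¹ * w) ^ n := by
    rw [← Complex.exp_nat_mul, mul_inv_cancel_left₀ hnC]
  have hnorm : ‖(n : ℂ)⁻¹ * w‖ = ‖w‖ / n := by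
    rw [norm_mul, norm_inv, Complex.norm_natCast, inv_mul_eq_div]
  have h2 : ‖Complex.exp ((n : ℂ)⁻¹ * w)‖ ≤ 1 := by
    rw [Complex.norm_exp, Real.exp_le_one_iff]
    have : ((n : ℂ)⁻¹ * w).re = (n : ℝ)⁻¹ * w.re := by
      rw [← Complex.ofReal_natCast, ← Complex.ofReal_inv, Complex.re_ofReal_mul]
    rw [this]
    exact mul_nonpos_of_nonneg_of_nonpos (by positivity) hre
  rw [e]
  refine (norm_pow_sub_pow_le_of_norm_le_one h1 h2 n).trans ?_
  have h3 := Complex.norm_exp_sub_one_sub_id_le (x := (n : ℂ)⁻¹ * w)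
    (by rw [hnorm, div_le_one hn']; exact hw)
  rw [norm_sub_rev, ← sub_sub]
  calc _ ≤ n * (‖w‖ / n) ^ 2 := by rw [← hnorm]; gcongr
    _ = _ := by field_simp

theorem norm_exp_I_mul_sub_one_le_two (x : ℝ) : ‖Complex.exp (Complex.I * x) - 1‖ ≤ 2 := by
  refine (norm_sub_le _ _).trans ?_
  rw [mul_comm, Complex.norm_exp_ofReal_mul_I]
  norm_num

theorem norm_exp_I_mul_sub_one_sub_le (x : ℝ) :
    ‖Complex.exp (Complex.I * x) - 1 - Complex.I * x‖ ≤ 3 * x ^ 2 := by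
  have hn : ‖Complex.I * (x : ℂ)‖ = |x| := by simp
  rcases le_total |x| 1 with h | h
  · refine (Complex.norm_exp_sub_one_sub_id_le (hn.trans_le h)).trans ?_
    rw [hn, sq_abs]
    nlinarith [sq_nonneg x]
  · refine (norm_sub_le _ _).trans ?_
    rw [hn]
    have := norm_exp_I_mul_sub_one_le_two x
    nlinarith [sq_abs x]

variable {d : ℕ}

/-- The integrand of the Lévy exponent. -/
noncomputable def levyIntegrand (t u : EuclideanSpace ℝ (Fin d)) : ℂ :=
  Complex.exp (Complex.I * ((⟪t, u⟫ : ℝ) : ℂ)) - 1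
    - Complex.I * ((if ‖u‖ ≤ 1 then ⟪t, u⟫ else 0 : ℝ) : ℂ)

theorem measurable_levyIntegrand (t : EuclideanSpace ℝ (Fin d)) :
    Measurable (levyIntegrand t) := by
  unfold levyIntegrand
  have h : Measurable fun u : EuclideanSpace ℝ (Fin d) => if ‖u‖ ≤ 1 then ⟪t, u⟫ else (0 : ℝ) :=
    Measurable.ite (measurableSet_le measurable_norm measurable_const) (by fun_prop)
      measurable_const
  fun_prop

theorem norm_levyIntegrand_le (t u : EuclideanSpace ℝ (Fin d)) :
    ‖levyIntegrand t u‖ ≤ (3 * ‖t‖ ^ 2 + 2) * min 1 (‖u‖ ^ 2) := by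
  unfold levyIntegrand
  split_ifs with h
  · rw [min_eq_right (pow_le_one₀ (norm_nonneg _) h)]
    refine (norm_exp_I_mul_sub_one_sub_le _).trans ?_
    have h1 : ⟪t, u⟫ ^ 2 ≤ ‖t‖ ^ 2 * ‖u‖ ^ 2 := by
      rw [← mul_pow, ← sq_abs]
      gcongr
      exact abs_real_inner_le_norm t u
    nlinarith [sq_nonneg ‖u‖]
  · rw [min_eq_left (one_le_pow₀ (not_le.1 h).le)]
    simp only [Complex.ofReal_zero, mul_zero, sub_zero, mul_one]
    have := norm_exp_I_mul_sub_one_le_two ⟪t, u⟫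
    nlinarith [sq_nonneg ‖t‖]

variable {ν : Measure (EuclideanSpace ℝ (Fin d))}

theorem IsLevyMeasure.integrable_min (hν : IsLevyMeasure ν) :
    Integrable (fun u => min 1 (‖u‖ ^ 2)) ν := by
  refine ⟨by fun_prop, ?_⟩
  rw [hasFiniteIntegral_iff_ofReal (.of_forall fun u => by positivity)]
  exact hν.lintegral_lt_top

theorem IsLevyMeasure.integrable_levyIntegrand (hν : IsLevyMeasure ν)
    (t : EuclideanSpace ℝ (Fin d)) : Integrable (levyIntegrand t) ν :=
  (hν.integrable_min.const_mul (3 * ‖t‖ ^ 2 + 2)).mono'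
    (measurable_levyIntegrand t).aestronglyMeasurable (.of_forall (norm_levyIntegrand_le t))

theorem IsLevyMeasure.measure_norm_gt_lt_top (hν : IsLevyMeasure ν) {δ : ℝ} (hδ : 0 < δ) :
    ν {u | δ < ‖u‖} < ∞ := by
  have hpos : 0 < min 1 (δ ^ 2) := by positivity
  refine lt_of_le_of_lt (measure_mono fun u hu => ?_) (hν.integrable_min.measure_ge_lt_top hpos)
  simp only [Set.mem_ofPred_eq] at hu ⊢
  gcongr

theorem measurableSet_norm_gt (δ : ℝ) :
    MeasurableSet {u : EuclideanSpace ℝ (Fin d) | δ < ‖u‖} :=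
  measurableSet_lt measurable_const measurable_norm

/-- The truncation sets exhaust everything but the origin, where the integrand vanishes. -/
theorem IsLevyMeasure.tendsto_setIntegral_levyIntegrand (hν : IsLevyMeasure ν)
    (t : EuclideanSpace ℝ (Fin d)) :
    Filter.Tendsto (fun k : ℕ => ∫ u in {u | 1 / ((k : ℝ) + 1) < ‖u‖}, levyIntegrand t u ∂ν)
      Filter.atTop (nhds (∫ u, levyIntegrand t u ∂ν)) := by
  have h := tendsto_setIntegral_of_monotone (μ := ν) (f := levyIntegrand t)
    (s := fun k : ℕ => {u | 1 / ((k : ℝ) + 1) < ‖u‖}) (fun k => measurableSet_norm_gt _)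
    (fun k l hkl u (hu : 1 / ((k : ℝ) + 1) < ‖u‖) =>
      (show 1 / ((l : ℝ) + 1) < ‖u‖ from (Nat.one_div_le_one_div hkl).trans_lt hu))
    (hν.integrable_levyIntegrand t).integrableOn
  convert h using 2
  rw [setIntegral_eq_integral_of_forall_compl_eq_zero]
  intro u hu
  have : u = 0 := by
    by_contra hne
    obtain ⟨n, hn⟩ := exists_nat_one_div_lt (norm_pos_iff.2 hne)
    exact hu (Set.mem_iUnion.2 ⟨n, hn⟩)
  simp [this, levyIntegrand]

theorem re_exp_I_mul_sub_one_nonpos (x : ℝ) : (Complex.exp (Complex.I * x) - 1).re ≤ 0 := by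
  rw [mul_comm, Complex.sub_re, Complex.exp_ofReal_mul_I_re, Complex.one_re]
  linarith [Real.cos_le_one x]

theorem integrable_exp_inner_sub_one (ν : Measure (EuclideanSpace ℝ (Fin d))) [IsFiniteMeasure ν]
    (t : EuclideanSpace ℝ (Fin d)) :
    Integrable (fun u => Complex.exp (Complex.I * ((⟪t, u⟫ : ℝ) : ℂ)) - 1) ν :=
  Integrable.of_bound (by fun_prop) 2 (.of_forall fun u => norm_exp_I_mul_sub_one_le_two _)

theorem re_integral_nonpos {α : Type*} [MeasurableSpace α] {μ : Measure α} {f : α → ℂ}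
    (hf : Integrable f μ) (h : ∀ u, (f u).re ≤ 0) : (∫ u, f u ∂μ).re ≤ 0 := by
  rw [← RCLike.re_eq_complex_re, ← integral_re hf]
  exact integral_nonpos h

theorem charFun_lazyStep [IsFiniteMeasure ν] {n : ℕ} (hn : 0 < n) (h : ν.real Set.univ ≤ n)
    (t : EuclideanSpace ℝ (Fin d)) :
    charFun (lazyStep ν n) t =
      1 + (n : ℂ)⁻¹ * ∫ u, (Complex.exp (Complex.I * ((⟪t, u⟫ : ℝ) : ℂ)) - 1) ∂ν := by
  rw [charFun_apply, integral_lazyStep ν hn h]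
  · rw [Complex.real_smul]
    simp only [inner_zero_left, Complex.ofReal_zero, zero_mul, Complex.exp_zero,
      Complex.ofReal_inv, Complex.ofReal_natCast]
    congr 3 with u
    rw [real_inner_comm, mul_comm]
  · refine Integrable.of_bound (by fun_prop) 1 (.of_forall fun u => ?_)
    rw [Complex.norm_exp_ofReal_mul_I]

theorem charFun_walkLaw (a : EuclideanSpace ℝ (Fin d)) (ρ : Measure (EuclideanSpace ℝ (Fin d)))
    [IsProbabilityMeasure ρ] (n : ℕ) (t : EuclideanSpace ℝ (Fin d)) :
    charFun (walkLaw a ρ n) t = Complex.exp (Complex.I * ((⟪t, a⟫ : ℝ) : ℂ)) * charFun ρ t ^ n := by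
  induction n with
  | zero => rw [walkLaw, charFun_dirac, real_inner_comm, mul_comm Complex.I]; simp
  | succ n ih => rw [walkLaw, charFun_conv, ih, pow_succ, mul_assoc]

/-- For a finite Lévy measure the compensator can be absorbed in the drift. -/
theorem integral_levyIntegrand_of_finite [IsFiniteMeasure ν] (t : EuclideanSpace ℝ (Fin d)) :
    ∫ u, levyIntegrand t u ∂ν =
      ∫ u, (Complex.exp (Complex.I * ((⟪t, u⟫ : ℝ) : ℂ)) - 1) ∂ν
        - Complex.I * ((⟪t, ∫ u in {u | ‖u‖ ≤ 1}, u ∂ν⟫ : ℝ) : ℂ) := by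
  have hs : MeasurableSet {u : EuclideanSpace ℝ (Fin d) | ‖u‖ ≤ 1} :=
    measurableSet_le measurable_norm measurable_const
  have hi : IntegrableOn (fun u => u) {u : EuclideanSpace ℝ (Fin d) | ‖u‖ ≤ 1} ν := by
    refine Integrable.of_bound (by fun_prop) 1 ?_
    exact (ae_restrict_iff' hs).2 (.of_forall fun u hu => hu)
  have e : (fun u : EuclideanSpace ℝ (Fin d) => if ‖u‖ ≤ 1 then ⟪t, u⟫ else (0 : ℝ))
      = Set.indicator {u | ‖u‖ ≤ 1} fun u => ⟪t, u⟫ := by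
    ext u
    simp [Set.indicator_apply]
  have hi2 : Integrable (fun u : EuclideanSpace ℝ (Fin d) =>
      if ‖u‖ ≤ 1 then ⟪t, u⟫ else (0 : ℝ)) ν := by
    rw [e, integrable_indicator_iff hs]
    exact hi.const_inner t
  unfold levyIntegrand
  have hi3 : Integrable (fun u : EuclideanSpace ℝ (Fin d) =>
      Complex.I * ((if ‖u‖ ≤ 1 then ⟪t, u⟫ else 0 : ℝ) : ℂ)) ν := hi2.ofReal.const_mul Complex.I
  rw [integral_sub (integrable_exp_inner_sub_one ν t) hi3, integral_const_mul]
  congr 2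
  rw [integral_complex_ofReal, e, integral_indicator hs, ← integral_inner hi]

/-- The exponential moment bound for `ID(γ, 0, ν)`. -/
theorem IsIDVector.integral_exp_le {Ω : Type*} [MeasurableSpace Ω] {P : Measure Ω}
    [IsProbabilityMeasure P] {X : Ω → EuclideanSpace ℝ (Fin d)} {γ : EuclideanSpace ℝ (Fin d)}
    (hX : IsIDVector X γ ν P) {R W : ℝ} (hR : 0 < R) (hW : 0 ≤ W)
    {g : EuclideanSpace ℝ (Fin d) → ℝ} (hgc : Continuous g) (hg : IncrBound ν R W g) {l : ℝ}
    (hl : 0 ≤ l) :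
    ∫ ω, Real.exp (l * g (X ω)) ∂P ≤
      Real.exp (l * ∫ ω, g (X ω) ∂P + W * ((Real.exp (l * R) - 1 - l * R) / R ^ 2)) := by
  have hν := hX.isLevyMeasure
  set s : ℕ → Set (EuclideanSpace ℝ (Fin d)) := fun k => {u | 1 / ((k : ℝ) + 1) < ‖u‖} with hs
  have hfin : ∀ k, IsFiniteMeasure (ν.restrict (s k)) := fun k =>
    ⟨by rw [Measure.restrict_apply_univ]; exact hν.measure_norm_gt_lt_top (by positivity)⟩
  set c : ℕ → ℝ := fun k => (ν.restrict (s k)).real Set.univ with hc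
  have hc0 : ∀ k, 0 ≤ c k := fun k => measureReal_nonneg
  -- The first term forces the error `(2 c_k)² / N_k` to be at most `1 / (k + 1)`; the rest ensures
  -- that `N_k` is positive and dominates both the mass `c_k` and the exponent, whose norm is at
  -- most `2 c_k`.
  choose N hN using fun k : ℕ => exists_nat_ge (((k : ℝ) + 1) * (2 * c k) ^ 2 + 2 * c k + 1)
  have hN1 : ∀ k, 2 * c k + 1 ≤ N k := fun k => by
    have : 0 ≤ ((k : ℝ) + 1) * (2 * c k) ^ 2 := by positivity
    linarith [hN k]
  have hNpos : ∀ k, 0 < N k := fun k => by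
    have : (0 : ℝ) < N k := by linarith [hN1 k, hc0 k]
    exact_mod_cast this
  have hcN : ∀ k, (ν.restrict (s k)).real Set.univ ≤ N k := fun k => by
    change c k ≤ N k
    linarith [hN1 k, hc0 k]
  have hprob : ∀ k, IsProbabilityMeasure (lazyStep (ν.restrict (s k)) (N k)) := fun k =>
    isProbabilityMeasure_lazyStep _ (hNpos k) (hcN k)
  -- The starting point carries the drift together with the compensator of the jumps that were kept.
  set a : ℕ → EuclideanSpace ℝ (Fin d) := fun k =>
    γ - ∫ u in {u | ‖u‖ ≤ 1}, u ∂(ν.restrict (s k)) with ha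
  set L : ℕ → ProbabilityMeasure (EuclideanSpace ℝ (Fin d)) := fun k =>
    ⟨walkLaw (a k) (lazyStep (ν.restrict (s k)) (N k)) (N k), inferInstance⟩ with hL
  have hPX : IsProbabilityMeasure (P.map X) :=
    Measure.isProbabilityMeasure_map hX.measurable.aemeasurable
  set L0 : ProbabilityMeasure (EuclideanSpace ℝ (Fin d)) := ⟨P.map X, hPX⟩ with hL0
  have hconv : Filter.Tendsto L Filter.atTop (nhds L0) := by
    refine ProbabilityMeasure.tendsto_of_tendsto_charFun fun t => ?_
    set w : ℕ → ℂ := fun k =>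
      ∫ u in s k, (Complex.exp (Complex.I * ((⟪t, u⟫ : ℝ) : ℂ)) - 1) ∂ν with hw
    set A : ℕ → ℂ := fun k => Complex.exp (Complex.I * ((⟪t, a k⟫ : ℝ) : ℂ)) with hA
    have hcf : ∀ k, charFun (L k : Measure (EuclideanSpace ℝ (Fin d))) t
        = A k * (1 + (N k : ℂ)⁻¹ * w k) ^ N k := fun k => by
      change charFun (walkLaw (a k) (lazyStep (ν.restrict (s k)) (N k)) (N k)) t = _
      rw [charFun_walkLaw, charFun_lazyStep (hNpos k) (hcN k)]
    have hwn : ∀ k, ‖w k‖ ≤ 2 * c k := fun k =>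
      norm_integral_le_of_norm_le_const (.of_forall fun u => norm_exp_I_mul_sub_one_le_two _)
    have hlim : ∀ k, A k * Complex.exp (w k) =
        Complex.exp (Complex.I * ((⟪t, γ⟫ : ℝ) : ℂ) + ∫ u in s k, levyIntegrand t u ∂ν) := fun k => by
      rw [integral_levyIntegrand_of_finite, hA, ← Complex.exp_add, ha]
      simp only [inner_sub_right, Complex.ofReal_sub, mul_sub]
      congr 1
      change _ - _ + w k = _ + (w k - _)
      ring
    have h1 : Filter.Tendsto (fun k => A k * Complex.exp (w k)) Filter.atTop
        (nhds (charFun (L0 : Measure (EuclideanSpace ℝ (Fin d))) t)) := by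
      have : charFun (L0 : Measure (EuclideanSpace ℝ (Fin d))) t = _ := hX.charFun_eq t
      rw [this]
      simp_rw [hlim]
      exact (Complex.continuous_exp.tendsto _).comp
        ((hν.tendsto_setIntegral_levyIntegrand t).const_add _)
    have h2 : Filter.Tendsto (fun k => A k * (1 + (N k : ℂ)⁻¹ * w k) ^ N k
        - A k * Complex.exp (w k)) Filter.atTop (nhds 0) := by
      refine squeeze_zero_norm (fun k => ?_) tendsto_one_div_add_atTop_nhds_zero_nat
      have hNk : (0 : ℝ) < N k := by exact_mod_cast hNpos k
      have h3 := norm_one_add_pow_sub_exp_le (w := w k) (hNpos k)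
        (by linarith [hwn k, hN1 k])
        -- The base of the power is a value of a characteristic function, hence in the unit disc.
        (by rw [← charFun_lazyStep (hNpos k) (hcN k)]; exact norm_charFun_le_one t)
        (by
          have hre := re_integral_nonpos (integrable_exp_inner_sub_one (ν.restrict (s k)) t)
            (fun u => re_exp_I_mul_sub_one_nonpos _)
          exact hre)
      rw [← mul_sub, norm_mul]
      have hA1 : ‖A k‖ = 1 := by
        change ‖Complex.exp (Complex.I * _)‖ = 1
        rw [mul_comm]
        exact Complex.norm_exp_ofReal_mul_I _
      rw [hA1, one_mul]
      refine h3.trans ?_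
      rw [div_le_div_iff₀ hNk (by positivity), one_mul]
      have : ‖w k‖ ^ 2 ≤ (2 * c k) ^ 2 := by gcongr; exact hwn k
      nlinarith [hN k, hc0 k]
    simp_rw [hcf]
    simpa using h2.add h1
  obtain ⟨C, hC⟩ := hg.bounded
  have hgm := hg.measurable
  rw [ProbabilityMeasure.tendsto_iff_forall_integral_tendsto] at hconv
  have c1 := hconv (BoundedContinuousFunction.ofNormedAddCommGroup g hgc C hC)
  have c2 := hconv (BoundedContinuousFunction.ofNormedAddCommGroup (fun x => Real.exp (l * g x))
    (by fun_prop) (Real.exp (l * C)) fun x => by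
      rw [Real.norm_eq_abs, Real.abs_exp]; gcongr; exact (le_abs_self _).trans (hC _))
  simp only [BoundedContinuousFunction.coe_ofNormedAddCommGroup] at c1 c2
  have m1 : ∫ x, g x ∂(L0 : Measure (EuclideanSpace ℝ (Fin d))) = ∫ ω, g (X ω) ∂P :=
    integral_map hX.measurable.aemeasurable hgm.aestronglyMeasurable
  have m2 : ∫ x, Real.exp (l * g x) ∂(L0 : Measure (EuclideanSpace ℝ (Fin d)))
      = ∫ ω, Real.exp (l * g (X ω)) ∂P :=
    integral_map hX.measurable.aemeasurable (by fun_prop)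
  rw [m1] at c1
  rw [m2] at c2
  refine le_of_tendsto_of_tendsto' c2
    ((Real.continuous_exp.tendsto _).comp ((c1.const_mul l).add_const _)) fun k => ?_
  -- Restricting `ν` only shrinks the increments, so `R` and `W` serve every `k`.
  have hgk : IncrBound (ν.restrict (s k)) R W g :=
    ⟨hgm, ⟨C, hC⟩, ae_restrict_of_ae hg.abs_le, fun x =>
      (lintegral_mono' Measure.restrict_le_self le_rfl).trans (hg.lintegral_le x)⟩
  have := integral_exp_walkLaw_le (hNpos k) (hcN k) hR hW hl (a k) (N k) hgk
  have hNk : (N k : ℝ) ≠ 0 := by exact_mod_cast (hNpos k).ne'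
  rwa [mul_inv_cancel_left₀ hNk] at this

end Exponent

/-! ### Independence and the support of the Lévy measure. -/

section Axes

variable {d : ℕ} {ν : Measure (EuclideanSpace ℝ (Fin d))}

theorem re_levyIntegrand (t u : EuclideanSpace ℝ (Fin d)) :
    (levyIntegrand t u).re = -(1 - Real.cos ⟪t, u⟫) := by
  unfold levyIntegrand
  rw [mul_comm Complex.I, mul_comm Complex.I, Complex.sub_re, Complex.sub_re,
    Complex.exp_ofReal_mul_I_re, Complex.one_re, Complex.re_ofReal_mul, Complex.I_re]
  ring

theorem IsLevyMeasure.integrable_one_sub_cos (hν : IsLevyMeasure ν)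
    (t : EuclideanSpace ℝ (Fin d)) : Integrable (fun u => 1 - Real.cos ⟪t, u⟫) ν := by
  have := (hν.integrable_levyIntegrand t).re.neg
  refine this.congr (.of_forall fun u => ?_)
  have h := re_levyIntegrand t u
  simp [h]

/-- Drift and compensator are purely imaginary, so the modulus of the characteristic function sees
only the jumps. -/
theorem IsLevyMeasure.re_levyExponent (hν : IsLevyMeasure ν) (γ t : EuclideanSpace ℝ (Fin d)) :
    (levyExponent γ ν t).re = -∫ u, (1 - Real.cos ⟪t, u⟫) ∂ν := by
  have h : levyExponent γ ν t = Complex.I * ((⟪t, γ⟫ : ℝ) : ℂ) + ∫ u, levyIntegrand t u ∂ν := rfl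
  rw [h, mul_comm, Complex.add_re, Complex.re_ofReal_mul, Complex.I_re, mul_zero, zero_add,
    ← RCLike.re_eq_complex_re, ← integral_re (hν.integrable_levyIntegrand t), ← integral_neg]
  congr 1 with u
  exact re_levyIntegrand t u

/-- The argument is nonzero and smaller than one period. Thus the countably many frequencies `1 / (n
+ 1)` suffice to detect a nonzero coordinate. -/
theorem cos_div_ne_one {x : ℝ} (hx : x ≠ 0) {n : ℕ} (hn : |x| < (n : ℝ) + 1) :
    Real.cos (1 / ((n : ℝ) + 1) * x) ≠ 1 := by
  have hn' : (0 : ℝ) < (n : ℝ) + 1 := by positivity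
  have h : |1 / ((n : ℝ) + 1) * x| < 1 := by
    rw [abs_mul, abs_of_pos (by positivity : 0 < 1 / ((n : ℝ) + 1)), one_div_mul_eq_div,
      div_lt_one hn']
    exact hn
  have h2 := abs_lt.1 h
  have := Real.pi_gt_three
  rw [Ne, Real.cos_eq_one_iff_of_lt_of_lt (by linarith) (by linarith)]
  exact mul_ne_zero (by positivity) hx

theorem inner_single (k : Fin d) (a : ℝ) (u : EuclideanSpace ℝ (Fin d)) :
    ⟪EuclideanSpace.single k a, u⟫ = a * u k := by
  rw [EuclideanSpace.inner_single_left]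
  simp

variable {Ω : Type*} [MeasurableSpace Ω] {P : Measure Ω}
  {X : Ω → EuclideanSpace ℝ (Fin d)} {γ : EuclideanSpace ℝ (Fin d)}

theorem IsIDVector.norm_charFun (hX : IsIDVector X γ ν P) (t : EuclideanSpace ℝ (Fin d)) :
    ‖charFun (P.map X) t‖ = Real.exp (-∫ u, (1 - Real.cos ⟪t, u⟫) ∂ν) := by
  rw [hX.charFun_eq, Complex.norm_exp, hX.isLevyMeasure.re_levyExponent]

theorem charFun_map_single_add_single (hX : Measurable X)
    (hindep : iIndepFun (fun (k : Fin d) (ω : Ω) => X ω k) P) {i j : Fin d} (hij : i ≠ j)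
    (a b : ℝ) :
    charFun (P.map X) (EuclideanSpace.single i a + EuclideanSpace.single j b) =
      charFun (P.map X) (EuclideanSpace.single i a) *
        charFun (P.map X) (EuclideanSpace.single j b) := by
  have hm : ∀ k, Measurable fun ω => X ω k := fun k => by fun_prop
  have e : ∀ t, charFun (P.map X) t = ∫ ω, Complex.exp (((⟪t, X ω⟫ : ℝ) : ℂ) * Complex.I) ∂P := by
    intro t
    rw [charFun_apply, integral_map hX.aemeasurable (by fun_prop)]
    simp_rw [real_inner_comm t]
  rw [e, e, e]
  simp only [inner_add_left, inner_single]
  rw [← (hindep.indepFun hij).integral_fun_comp_mul_comp (hm i).aemeasurable (hm j).aemeasurable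
    (f := fun x => Complex.exp (((a * x : ℝ) : ℂ) * Complex.I))
    (g := fun x => Complex.exp (((b * x : ℝ) : ℂ) * Complex.I)) (by fun_prop) (by fun_prop)]
  congr 1 with ω
  rw [← Complex.exp_add]
  push_cast
  ring_nf

/-- Independent components force the Lévy measure to be carried by the coordinate axes. -/
theorem IsIDVector.ae_eq_zero_or_eq_zero (hX : IsIDVector X γ ν P)
    (hindep : iIndepFun (fun (k : Fin d) (ω : Ω) => X ω k) P) :
    ∀ᵐ u ∂ν, ∀ i j, i ≠ j → u i = 0 ∨ u j = 0 := by
  have hν := hX.isLevyMeasure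
  simp only [ae_all_iff]
  intro i j hij
  set J : EuclideanSpace ℝ (Fin d) → ℝ := fun t => ∫ u, (1 - Real.cos ⟪t, u⟫) ∂ν with hJ
  -- Taking moduli in the factorised characteristic function avoids complex logarithms.
  have hadd : ∀ a b : ℝ, J (EuclideanSpace.single i a + EuclideanSpace.single j b) =
      J (EuclideanSpace.single i a) + J (EuclideanSpace.single j b) := fun a b => by
    have h := congrArg norm (charFun_map_single_add_single hX.measurable hindep hij a b)
    rw [norm_mul, hX.norm_charFun, hX.norm_charFun, hX.norm_charFun, ← Real.exp_add,
      Real.exp_eq_exp] at h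
    change -J _ = -J _ + -J _ at h
    linarith
  have hprod : ∀ a : ℝ, ∀ᵐ u ∂ν, (1 - Real.cos (a * u i)) * (1 - Real.cos (a * u j)) = 0 := by
    intro a
    have hi := hν.integrable_one_sub_cos
    -- This rests on `cos A cos B = (cos (A + B) + cos (A - B)) / 2`. Since `J` is additive and
    -- even, the right side integrates to zero, while the left side is nonnegative.
    have e : ∀ u : EuclideanSpace ℝ (Fin d),
        (1 - Real.cos (a * u i)) * (1 - Real.cos (a * u j)) =
        ((1 - Real.cos ⟪EuclideanSpace.single i a, u⟫) +
          (1 - Real.cos ⟪EuclideanSpace.single j a, u⟫)) -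
        ((1 - Real.cos ⟪EuclideanSpace.single i a + EuclideanSpace.single j a, u⟫) +
        (1 - Real.cos ⟪EuclideanSpace.single i a + EuclideanSpace.single j (-a), u⟫)) / 2 := by
      intro u
      simp only [inner_add_left, inner_single, neg_mul, Real.cos_add, Real.cos_neg, Real.sin_neg]
      ring
    have hi2 : ∀ s t : EuclideanSpace ℝ (Fin d), Integrable
        (fun u => (1 - Real.cos ⟪s, u⟫) + (1 - Real.cos ⟪t, u⟫)) ν := fun s t => (hi s).add (hi t)
    have hJ2 : ∀ s t : EuclideanSpace ℝ (Fin d),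
        ∫ u, ((1 - Real.cos ⟪s, u⟫) + (1 - Real.cos ⟪t, u⟫)) ∂ν = J s + J t := fun s t =>
      integral_add (hi s) (hi t)
    have hint' : Integrable (fun u : EuclideanSpace ℝ (Fin d) =>
        (1 - Real.cos (a * u i)) * (1 - Real.cos (a * u j))) ν :=
      ((hi2 _ _).sub ((hi2 _ _).div_const 2)).congr (.of_forall fun u => (e u).symm)
    have hzero : ∫ u, (1 - Real.cos (a * u i)) * (1 - Real.cos (a * u j)) ∂ν = 0 := by
      simp_rw [e]
      rw [integral_sub (hi2 _ _) ((hi2 _ _).div_const 2), integral_div, hJ2, hJ2, hadd, hadd]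
      have hneg : J (EuclideanSpace.single j (-a)) = J (EuclideanSpace.single j a) := by
        simp only [hJ, inner_single, neg_mul, Real.cos_neg]
      rw [hneg]
      ring
    have h := (integral_eq_zero_iff_of_nonneg (fun u => mul_nonneg
      (sub_nonneg.2 (Real.cos_le_one _)) (sub_nonneg.2 (Real.cos_le_one _))) hint').1 hzero
    exact h
  have hall : ∀ᵐ u ∂ν, ∀ n : ℕ, (1 - Real.cos (1 / ((n : ℝ) + 1) * u i)) *
      (1 - Real.cos (1 / ((n : ℝ) + 1) * u j)) = 0 := ae_all_iff.2 fun n => hprod _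
  filter_upwards [hall] with u hu
  by_contra! hne
  obtain ⟨n, hn⟩ := exists_nat_ge (max |u i| |u j|)
  have h1 : |u i| < (n : ℝ) + 1 := by linarith [le_max_left |u i| |u j|]
  have h2 : |u j| < (n : ℝ) + 1 := by linarith [le_max_right |u i| |u j|]
  rcases mul_eq_zero.1 (hu n) with h | h
  · exact cos_div_ne_one hne.1 h1 (by linarith)
  · exact cos_div_ne_one hne.2 h2 (by linarith)

theorem IsLevyMeasure.eq_zero_of_ae_eq_zero (hν : IsLevyMeasure ν) (h : ∀ᵐ u ∂ν, u = 0) :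
    ν = 0 := by
  rw [← Measure.measure_univ_eq_zero]
  have h2 : ν {u | ¬ u = 0} = 0 := h
  refine measure_mono_null (fun u _ => ?_) (measure_union_null hν.no_atom h2)
  by_cases hu : u = 0
  · exact Or.inl hu
  · exact Or.inr hu

theorem IsLevyMeasure.eq_zero_of_coord (hν : IsLevyMeasure ν) (h : ∀ k, ∀ᵐ u ∂ν, u k = 0) :
    ν = 0 := by
  refine hν.eq_zero_of_ae_eq_zero ?_
  filter_upwards [ae_all_iff.2 h] with u hu
  ext k
  simpa using hu k

/-- A degenerate infinitely divisible vector has no jumps. -/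
theorem IsIDVector.eq_zero_of_ae_eq_zero [IsProbabilityMeasure P] (hX : IsIDVector X γ ν P) (h0 : ∀ᵐ ω ∂P, X ω = 0) :
    ν = 0 := by
  have hν := hX.isLevyMeasure
  have hJ : ∀ t, ∫ u, (1 - Real.cos ⟪t, u⟫) ∂ν = 0 := fun t => by
    have h1 : charFun (P.map X) t = 1 := by
      rw [charFun_apply, integral_map hX.measurable.aemeasurable (by fun_prop)]
      have : ∀ᵐ ω ∂P, Complex.exp (((⟪X ω, t⟫ : ℝ) : ℂ) * Complex.I) = 1 := by
        filter_upwards [h0] with ω hω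
        simp [hω]
      rw [integral_congr_ae this]
      simp
    have h2 := hX.norm_charFun t
    rw [h1, norm_one, eq_comm, Real.exp_eq_one_iff] at h2
    linarith
  refine hν.eq_zero_of_coord fun k => ?_
  have hall : ∀ᵐ u ∂ν, ∀ n : ℕ, 1 - Real.cos (1 / ((n : ℝ) + 1) * u k) = 0 := by
    refine ae_all_iff.2 fun n => ?_
    have h := (integral_eq_zero_iff_of_nonneg (fun u => sub_nonneg.2 (Real.cos_le_one _))
      (hν.integrable_one_sub_cos _)).1 (hJ (EuclideanSpace.single k (1 / ((n : ℝ) + 1))))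
    filter_upwards [h] with u hu
    simpa [inner_single] using hu
  filter_upwards [hall] with u hu
  by_contra hne
  obtain ⟨n, hn⟩ := exists_nat_ge |u k|
  exact cos_div_ne_one hne (n := n) (by linarith) (by linarith [hu n])

end Axes

/-! ### Support radii and integration along the axes. -/

section Radius

/-- Radii exceeding the infimum by less than `1 / (n + 1)` are admissible; the countably many null
sets are then discarded together. -/
theorem ae_abs_le_supportRadius {μ : Measure ℝ} (h : supportRadius μ ≠ ∞) :
    ∀ᵐ u ∂μ, |u| ≤ (supportRadius μ).toReal := by
  have hall : ∀ᵐ u ∂μ, ∀ n : ℕ, |u| ≤ (supportRadius μ).toReal + 1 / ((n : ℝ) + 1) := by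
    refine ae_all_iff.2 fun n => ?_
    have hpos : (0 : ℝ) < 1 / ((n : ℝ) + 1) := by positivity
    have hlt : supportRadius μ < ENNReal.ofReal ((supportRadius μ).toReal + 1 / ((n : ℝ) + 1)) := by
      rw [ENNReal.lt_ofReal_iff_toReal_lt h]
      linarith
    obtain ⟨_, ⟨ρ, ⟨hρ, hμ⟩, rfl⟩, hr⟩ := sInf_lt_iff.1 hlt
    have hρ' : ρ < (supportRadius μ).toReal + 1 / ((n : ℝ) + 1) :=
      (ENNReal.ofReal_lt_ofReal_iff_of_nonneg hρ.le).1 hr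
    have hae : ∀ᵐ u ∂μ, ¬ ρ < |u| := measure_eq_zero_iff_ae_notMem.1 hμ
    filter_upwards [hae] with u hu
    linarith
  filter_upwards [hall] with u hu
  exact ge_of_tendsto' (by simpa using
    (tendsto_one_div_add_atTop_nhds_zero_nat (𝕜 := ℝ)).const_add (supportRadius μ).toReal) hu

variable {d : ℕ} {ν : Measure (EuclideanSpace ℝ (Fin d))}

theorem toReal_supportRadius_le_maxRadius (hR : ∀ k, supportRadius (axisLevyMeasure ν k) ≠ ∞)
    (k : Fin d) : (supportRadius (axisLevyMeasure ν k)).toReal ≤ maxRadius ν := by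
  refine ENNReal.toReal_mono (ne_top_of_le_ne_top (ENNReal.sum_ne_top.2 fun k _ => hR k)
    (iSup_le fun j => Finset.single_le_sum (f := fun k => supportRadius (axisLevyMeasure ν k))
      (fun _ _ => zero_le) (Finset.mem_univ j))) ?_
  exact le_iSup (fun k => supportRadius (axisLevyMeasure ν k)) k

theorem measurableSet_axis (k : Fin d) :
    MeasurableSet {u : EuclideanSpace ℝ (Fin d) | ∀ j, j ≠ k → u j = 0} := by
  have : {u : EuclideanSpace ℝ (Fin d) | ∀ j, j ≠ k → u j = 0}
      = ⋂ j, ⋂ (_ : j ≠ k), {u | u j = 0} := by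
    ext u; simp
  rw [this]
  exact MeasurableSet.iInter fun j => MeasurableSet.iInter fun _ =>
    measurableSet_eq_fun (by fun_prop) measurable_const

/-- The jumps along the axes are bounded by `maxRadius ν`. -/
theorem ae_exists_eq_single (h0 : ∀ᵐ u ∂ν, u ≠ 0)
    (hax : ∀ᵐ u ∂ν, ∀ i j, i ≠ j → u i = 0 ∨ u j = 0)
    (hR : ∀ k, supportRadius (axisLevyMeasure ν k) ≠ ∞) :
    ∀ᵐ u ∂ν, ∃ k v, v ≠ 0 ∧ |v| ≤ maxRadius ν ∧ u = EuclideanSpace.single k v := by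
  have hb : ∀ᵐ u ∂ν, ∀ k, (∀ j, j ≠ k → u j = 0) → |u k| ≤ maxRadius ν := by
    refine ae_all_iff.2 fun k => ?_
    have h := ae_abs_le_supportRadius (hR k)
    have h2 := ae_of_ae_map (f := fun u : EuclideanSpace ℝ (Fin d) => u k) (by fun_prop) h
    rw [ae_restrict_iff' (measurableSet_axis k)] at h2
    filter_upwards [h2] with u hu hk
    exact (hu hk).trans (toReal_supportRadius_le_maxRadius hR k)
  filter_upwards [h0, hax, hb] with u hu0 hua hub
  obtain ⟨k, hk⟩ : ∃ k, u k ≠ 0 := by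
    by_contra! h
    exact hu0 (by ext k; simpa using h k)
  have hj : ∀ j, j ≠ k → u j = 0 := fun j hj => (hua j k hj).resolve_right hk
  refine ⟨k, u k, hk, hub k hj, ?_⟩
  ext j
  by_cases hjk : j = k
  · subst hjk; simp
  · simp [hjk, hj j hjk]

theorem integrable_axis_iff {k : Fin d} {f : ℝ → ℝ} (hf : Measurable f) :
    Integrable f (axisLevyMeasure ν k) ↔
      IntegrableOn (fun u => f (u k)) {u | ∀ j, j ≠ k → u j = 0} ν := by
  rw [axisLevyMeasure, integrable_map_measure hf.aestronglyMeasurable (by fun_prop)]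
  rfl

/-- Almost every jump off the `k`-th axis lies on another one, so its `k`-th coordinate is zero and
`f 0 = 0` removes it. -/
theorem integral_axis (hax : ∀ᵐ u ∂ν, ∀ i j, i ≠ j → u i = 0 ∨ u j = 0) (k : Fin d) {f : ℝ → ℝ}
    (hf : Measurable f) (hf0 : f 0 = 0) :
    ∫ x, f x ∂(axisLevyMeasure ν k) = ∫ u, f (u k) ∂ν := by
  rw [axisLevyMeasure, integral_map (by fun_prop) hf.aestronglyMeasurable]
  refine setIntegral_eq_integral_of_ae_compl_eq_zero ?_
  filter_upwards [hax] with u hu hk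
  have : ∃ j, j ≠ k ∧ u j ≠ 0 := by
    by_contra! h
    exact hk h
  obtain ⟨j, hjk, hj⟩ := this
  rw [(hu j k hjk).resolve_left hj, hf0]

end Radius

/-! ### Increments of the clipped norm. -/

section TruncNorm

variable {d : ℕ}

/-- The Euclidean norm, clipped to the interval `[e, M]`. -/
noncomputable def clippedNorm (e M : ℝ) (x : EuclideanSpace ℝ (Fin d)) : ℝ := min (max ‖x‖ e) M

theorem continuous_clippedNorm (e M : ℝ) : Continuous (clippedNorm (d := d) e M) := by
  unfold clippedNorm
  fun_prop

theorem abs_clippedNorm_le {e M : ℝ} (hM : 0 ≤ M) (x : EuclideanSpace ℝ (Fin d)) :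
    |clippedNorm e M x| ≤ M := by
  have h1 : clippedNorm e M x ≤ M := min_le_right _ _
  have h2 : 0 ≤ clippedNorm e M x := le_min (le_max_of_le_left (norm_nonneg x)) hM
  rwa [abs_of_nonneg h2]

theorem abs_clippedNorm_sub_le_max (e M : ℝ) (x y : EuclideanSpace ℝ (Fin d)) :
    |clippedNorm e M y - clippedNorm e M x| ≤ |max ‖y‖ e - max ‖x‖ e| := by
  refine (abs_min_sub_min_le_max _ _ _ _).trans ?_
  simp

theorem abs_clippedNorm_sub_le (e M : ℝ) (x u : EuclideanSpace ℝ (Fin d)) :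
    |clippedNorm e M (x + u) - clippedNorm e M x| ≤ ‖u‖ := by
  refine (abs_clippedNorm_sub_le_max e M x (x + u)).trans
    ((abs_max_sub_max_le_max _ _ _ _).trans ?_)
  simpa using abs_norm_sub_norm_le (x + u) x

/-- With `p` and `q` the clipped values, `|p - q| q ≤ |p² - q²|`, and clipping the squares from
below at `e²` is a contraction. -/
theorem sq_max_sub_max_mul_le {a b e : ℝ} (ha : 0 ≤ a) (hb : 0 ≤ b) (he : 0 ≤ e) :
    (max b e - max a e) ^ 2 * max a e ^ 2 ≤ (b ^ 2 - a ^ 2) ^ 2 := by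
  rw [← mul_pow, sq_le_sq]
  have hq : 0 ≤ max a e := le_max_of_le_left ha
  have hp : 0 ≤ max b e := le_max_of_le_left hb
  have hsq : ∀ {c : ℝ}, 0 ≤ c → max c e ^ 2 = max (c ^ 2) (e ^ 2) := fun {c} hc => by
    rcases le_total c e with h | h
    · rw [max_eq_right h, max_eq_right (by gcongr)]
    · rw [max_eq_left h, max_eq_left (by gcongr)]
  calc |(max b e - max a e) * max a e| = |max b e - max a e| * max a e := by
        rw [abs_mul, abs_of_nonneg hq]
    _ ≤ |max b e - max a e| * (max b e + max a e) := by gcongr; linarith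
    _ = |max b e ^ 2 - max a e ^ 2| := by
        rw [sq_sub_sq, abs_mul, abs_of_nonneg (add_nonneg hp hq), mul_comm]
    _ ≤ |b ^ 2 - a ^ 2| := by
        rw [hsq ha, hsq hb]
        refine (abs_max_sub_max_le_max _ _ _ _).trans ?_
        simp

/-- The constants come from `(2 v x_k + v²)² ≤ 8 v² x_k² + 2 v⁴`, divided by the squared clipped
norm. The quadratic term keeps the weight `x_k² / max ‖x‖ e ^ 2` for later summation; only the
quartic term uses the floor `e`. -/
theorem sq_clippedNorm_add_single_sub_le {e : ℝ} (he : 0 < e) (M : ℝ)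
    (x : EuclideanSpace ℝ (Fin d)) (k : Fin d) (v : ℝ) :
    (clippedNorm e M (x + EuclideanSpace.single k v) - clippedNorm e M x) ^ 2 ≤
      8 * (x k ^ 2 / max ‖x‖ e ^ 2) * v ^ 2 + 2 / e ^ 2 * v ^ 4 := by
  set q := max ‖x‖ e with hq
  have hqe : e ≤ q := le_max_right _ _
  have hq0 : 0 < q := he.trans_le hqe
  set p := max ‖x + EuclideanSpace.single k v‖ e with hp
  have h1 : (clippedNorm e M (x + EuclideanSpace.single k v) - clippedNorm e M x) ^ 2
      ≤ (p - q) ^ 2 := by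
    rw [sq_le_sq]
    exact abs_clippedNorm_sub_le_max _ _ _ _
  have h2 := sq_max_sub_max_mul_le (norm_nonneg x)
    (norm_nonneg (x + EuclideanSpace.single k v)) he.le
  have h3 : ‖x + EuclideanSpace.single k v‖ ^ 2 - ‖x‖ ^ 2 = 2 * v * x k + v ^ 2 := by
    rw [norm_add_sq_real, real_inner_comm, inner_single, PiLp.norm_single,
      Real.norm_eq_abs, sq_abs]
    ring
  rw [← hp, ← hq, h3] at h2
  have h4 : (p - q) ^ 2 ≤ (8 * x k ^ 2 * v ^ 2 + 2 * v ^ 4) / q ^ 2 := by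
    rw [le_div_iff₀ (by positivity)]
    nlinarith [sq_nonneg (2 * v * x k - v ^ 2)]
  have h5 : 2 / q ^ 2 * v ^ 4 ≤ 2 / e ^ 2 * v ^ 4 := by gcongr
  calc _ ≤ _ := h1
    _ ≤ _ := h4
    _ = 8 * (x k ^ 2 / q ^ 2) * v ^ 2 + 2 / q ^ 2 * v ^ 4 := by field_simp
    _ ≤ _ := by linarith

end TruncNorm

/-! ### Integrability and increment bounds under bounded jumps. -/

section Moments

variable {d : ℕ} {ν : Measure (EuclideanSpace ℝ (Fin d))}

theorem IsLevyMeasure.ae_ne_zero (hν : IsLevyMeasure ν) : ∀ᵐ u ∂ν, u ≠ 0 :=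
  measure_eq_zero_iff_ae_notMem.1 hν.no_atom

theorem IsLevyMeasure.integrable_sq_norm (hν : IsLevyMeasure ν) {R : ℝ}
    (hb : ∀ᵐ u ∂ν, ‖u‖ ≤ R) : Integrable (fun u => ‖u‖ ^ 2) ν := by
  refine (hν.integrable_min.const_mul (1 + R ^ 2)).mono' (by fun_prop) ?_
  filter_upwards [hb] with u hu
  rw [Real.norm_eq_abs, abs_of_nonneg (sq_nonneg _)]
  have h1 : ‖u‖ ^ 2 ≤ R ^ 2 := by gcongr
  rcases le_total 1 (‖u‖ ^ 2) with h | h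
  · rw [min_eq_left h]; linarith
  · rw [min_eq_right h]; nlinarith [sq_nonneg ‖u‖, sq_nonneg R]

theorem abs_coord_le_norm (u : EuclideanSpace ℝ (Fin d)) (k : Fin d) : |u k| ≤ ‖u‖ := by
  simpa using PiLp.norm_apply_le u k

theorem IsLevyMeasure.integrable_sq_coord (hν : IsLevyMeasure ν) {R : ℝ}
    (hb : ∀ᵐ u ∂ν, ‖u‖ ≤ R) (k : Fin d) : Integrable (fun u => u k ^ 2) ν := by
  refine (hν.integrable_sq_norm hb).mono' (by fun_prop) (.of_forall fun u => ?_)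
  rw [Real.norm_eq_abs, abs_pow]
  gcongr
  exact abs_coord_le_norm u k

theorem IsLevyMeasure.integrable_four_coord (hν : IsLevyMeasure ν) {R : ℝ}
    (hb : ∀ᵐ u ∂ν, ‖u‖ ≤ R) (k : Fin d) : Integrable (fun u => u k ^ 4) ν := by
  refine ((hν.integrable_sq_norm hb).const_mul (R ^ 2)).mono' (by fun_prop) ?_
  filter_upwards [hb] with u hu
  rw [Real.norm_eq_abs, abs_pow]
  calc |u k| ^ 4 ≤ ‖u‖ ^ 4 := by gcongr; exact abs_coord_le_norm u k
    _ = ‖u‖ ^ 2 * ‖u‖ ^ 2 := by ring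
    _ ≤ R ^ 2 * ‖u‖ ^ 2 := by gcongr

theorem IncrBound.neg {R W : ℝ} {g : EuclideanSpace ℝ (Fin d) → ℝ} (hg : IncrBound ν R W g) :
    IncrBound ν R W (fun x => -g x) := by
  have e : ∀ x u, -g (x + u) - -g x = -(g (x + u) - g x) := fun x u => by ring
  refine ⟨hg.measurable.neg, ?_, ?_, fun x => ?_⟩
  · obtain ⟨C, hC⟩ := hg.bounded
    exact ⟨C, fun x => by rw [abs_neg]; exact hC x⟩
  · filter_upwards [hg.abs_le] with u hu x
    rw [e, abs_neg]
    exact hu x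
  · simp_rw [e, neg_sq]
    exact hg.lintegral_le x

/-- Clipping keeps the norm 1-Lipschitz. This cruder variance needs no positive floor, so it is
available before `𝔼‖X‖` is known to be finite. -/
theorem IsLevyMeasure.incrBound_clippedNorm_of_norm_le (hν : IsLevyMeasure ν) {R : ℝ}
    (hb : ∀ᵐ u ∂ν, ‖u‖ ≤ R) (e : ℝ) {M : ℝ} (hM : 0 ≤ M) :
    IncrBound ν R (∫ u, ‖u‖ ^ 2 ∂ν) (clippedNorm e M) := by
  refine ⟨(continuous_clippedNorm e M).measurable, ⟨M, abs_clippedNorm_le hM⟩, ?_, fun x => ?_⟩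
  · filter_upwards [hb] with u hu x
    exact (abs_clippedNorm_sub_le e M x u).trans hu
  · rw [ofReal_integral_eq_lintegral_ofReal (hν.integrable_sq_norm hb)
      (.of_forall fun u => sq_nonneg _)]
    refine lintegral_mono fun u => ENNReal.ofReal_le_ofReal ?_
    rw [sq_le_sq, abs_norm]
    exact abs_clippedNorm_sub_le e M x u

variable {Ω : Type*} [MeasurableSpace Ω] {P : Measure Ω} [IsProbabilityMeasure P]
  {X : Ω → EuclideanSpace ℝ (Fin d)} {γ : EuclideanSpace ℝ (Fin d)}

/-- Bounded jumps imply a finite first moment. -/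
theorem IsIDVector.integrable_norm (hX : IsIDVector X γ ν P) {R : ℝ} (hR : 0 < R)
    (hb : ∀ᵐ u ∂ν, ‖u‖ ≤ R) : Integrable (fun ω => ‖X ω‖) P := by
  have hν := hX.isLevyMeasure
  have hXm := hX.measurable
  set W := ∫ u, ‖u‖ ^ 2 ∂ν with hW
  have hW0 : 0 ≤ W := integral_nonneg fun u => sq_nonneg _
  set κ := W * ((Real.exp (1 * R) - 1 - 1 * R) / R ^ 2) with hκ
  set I := ∫ ω, Real.exp (-‖X ω‖) ∂P with hI
  have hint : Integrable (fun ω => Real.exp (-‖X ω‖)) P :=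
    integrable_of_abs_le (C := 1) (by fun_prop) fun ω => by
      rw [Real.abs_exp, Real.exp_le_one_iff]; simp
  have hI0 : 0 < I := integral_exp_pos hint
  have hclip : ∀ (n : ℕ) (x : EuclideanSpace ℝ (Fin d)), clippedNorm 0 n x = min ‖x‖ n :=
    fun n x => by rw [clippedNorm, max_eq_left (norm_nonneg x)]
  -- The exponential bound for minus the truncated norm, with `l = 1`, controls its mean through `𝔼
  -- exp (-min ‖X‖ n)`, which is at least `I > 0` for all `n`.
  have hmean : ∀ n : ℕ, ∫ ω, min ‖X ω‖ n ∂P ≤ κ - Real.log I := fun n => by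
    have h := hX.integral_exp_le (g := fun x => -clippedNorm 0 (n : ℝ) x) hR hW0
      (continuous_clippedNorm 0 (n : ℝ)).neg
      (hν.incrBound_clippedNorm_of_norm_le hb 0 n.cast_nonneg).neg (l := 1) zero_le_one
    simp only [hclip, one_mul, integral_neg] at h
    have h2 : I ≤ ∫ ω, Real.exp (-min ‖X ω‖ n) ∂P := by
      refine integral_mono hint ?_ fun ω => ?_
      · refine integrable_of_abs_le (C := 1) (by fun_prop) fun ω => ?_
        rw [Real.abs_exp, Real.exp_le_one_iff, neg_nonpos]
        positivity
      · exact Real.exp_le_exp.2 (neg_le_neg (min_le_left _ _))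
    have h3 := (Real.log_le_iff_le_exp hI0).2 (h2.trans h)
    rw [hκ, one_mul]
    linarith
  refine ⟨by fun_prop, ?_⟩
  rw [hasFiniteIntegral_iff_ofReal (.of_forall fun ω => norm_nonneg _)]
  have hsup : ∀ ω, ENNReal.ofReal ‖X ω‖ = ⨆ n : ℕ, ENNReal.ofReal (min ‖X ω‖ n) := fun ω => by
    refine le_antisymm ?_ (iSup_le fun n => ENNReal.ofReal_le_ofReal (min_le_left _ _))
    obtain ⟨n, hn⟩ := exists_nat_ge ‖X ω‖
    refine le_iSup_of_le n ?_
    rw [min_eq_left hn]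
  simp_rw [hsup]
  rw [lintegral_iSup (f := fun (n : ℕ) ω => ENNReal.ofReal (min ‖X ω‖ n))
    (fun n => by fun_prop) fun m n hmn ω => ENNReal.ofReal_le_ofReal
    (min_le_min_left _ (Nat.cast_le.2 hmn))]
  refine lt_of_le_of_lt (iSup_le fun n => ?_) (ENNReal.ofReal_lt_top (r := κ - Real.log I))
  rw [← ofReal_integral_eq_lintegral_ofReal
    (integrable_of_abs_le (C := n) (by fun_prop) fun ω => ?_)
    (.of_forall fun ω => le_min (norm_nonneg _) n.cast_nonneg)]
  · exact ENNReal.ofReal_le_ofReal (hmean n)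
  · rw [abs_of_nonneg (le_min (norm_nonneg _) n.cast_nonneg)]
    exact min_le_right _ _

theorem IsLevyMeasure.incrBound_clippedNorm (hν : IsLevyMeasure ν) {R : ℝ}
    (hax : ∀ᵐ u ∂ν, ∀ i j, i ≠ j → u i = 0 ∨ u j = 0)
    (hs : ∀ᵐ u ∂ν, ∃ (k : Fin d) (v : ℝ), u = EuclideanSpace.single k v)
    (hb : ∀ᵐ u ∂ν, ‖u‖ ≤ R) {ε m : ℝ} (he : 0 < ε * m) {M : ℝ} (hM : 0 ≤ M) :
    IncrBound ν R (varianceFactor ν ε m) (clippedNorm (ε * m) M) := by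
  refine ⟨(continuous_clippedNorm _ M).measurable, ⟨M, abs_clippedNorm_le hM⟩,
    (hν.incrBound_clippedNorm_of_norm_le hb _ hM).abs_le, fun x => ?_⟩
  set e := ε * m with he'
  set q := max ‖x‖ e with hq
  have hq0 : 0 < q := lt_max_of_lt_right he
  have h2 := hν.integrable_sq_coord hb
  have h4 := hν.integrable_four_coord hb
  set F : EuclideanSpace ℝ (Fin d) → ℝ := fun u =>
    ∑ k, (8 * (x k ^ 2 / q ^ 2) * u k ^ 2 + 2 / e ^ 2 * u k ^ 4) with hF
  have hterm : ∀ k, Integrable (fun u : EuclideanSpace ℝ (Fin d) =>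
      8 * (x k ^ 2 / q ^ 2) * u k ^ 2 + 2 / e ^ 2 * u k ^ 4) ν := fun k =>
    ((h2 k).const_mul _).add ((h4 k).const_mul _)
  have hFi : Integrable F ν := integrable_finsetSum _ fun k _ => hterm k
  have hpt : ∀ᵐ u ∂ν, (clippedNorm e M (x + u) - clippedNorm e M x) ^ 2 ≤ F u := by
    filter_upwards [hs] with u ⟨k, v, hu⟩
    have hk : u k = v := by simp [hu]
    refine (hu ▸ sq_clippedNorm_add_single_sub_le he M x k v).trans ?_
    rw [← hk]
    exact Finset.single_le_sum (f := fun k => 8 * (x k ^ 2 / q ^ 2) * u k ^ 2 + 2 / e ^ 2 * u k ^ 4)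
      (fun k _ => by positivity) (Finset.mem_univ k)
  have hFint : ∫ u, F u ∂ν ≤ varianceFactor ν ε m := by
    rw [hF, integral_finsetSum _ fun k _ => hterm k, varianceFactor]
    have e1 : ∀ k, ∫ u : EuclideanSpace ℝ (Fin d),
        (8 * (x k ^ 2 / q ^ 2) * u k ^ 2 + 2 / e ^ 2 * u k ^ 4) ∂ν =
        8 * (x k ^ 2 / q ^ 2) * (∫ y, y ^ 2 ∂(axisLevyMeasure ν k)) +
          2 / e ^ 2 * ∫ y, y ^ 4 ∂(axisLevyMeasure ν k) := fun k => by
      rw [integral_add ((h2 k).const_mul _) ((h4 k).const_mul _), integral_const_mul,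
        integral_const_mul, integral_axis hax k (f := fun y => y ^ 2) (by fun_prop) (by simp),
        integral_axis hax k (f := fun y => y ^ 4) (by fun_prop) (by simp)]
    simp_rw [e1]
    rw [Finset.sum_add_distrib, ← Finset.mul_sum]
    set S := ⨆ k, ∫ y, y ^ 2 ∂(axisLevyMeasure ν k) with hS
    have hSk : ∀ k, ∫ y, y ^ 2 ∂(axisLevyMeasure ν k) ≤ S := fun k =>
      le_ciSup (f := fun k => ∫ y, y ^ 2 ∂(axisLevyMeasure ν k)) (Set.finite_range _).bddAbove k
    have hS0 : 0 ≤ S := Real.iSup_nonneg fun k => integral_nonneg fun y => sq_nonneg _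
    -- These weights turn the sum of second moments into their maximum.
    have hsum : ∑ k, x k ^ 2 / q ^ 2 ≤ 1 := by
      rw [← Finset.sum_div, div_le_one (by positivity), ← EuclideanSpace.real_norm_sq_eq]
      gcongr
      exact le_max_left _ _
    have : ∑ k, 8 * (x k ^ 2 / q ^ 2) * (∫ y, y ^ 2 ∂(axisLevyMeasure ν k)) ≤ 8 * S := by
      calc _ ≤ ∑ k, 8 * (x k ^ 2 / q ^ 2) * S :=
            Finset.sum_le_sum fun k _ => by gcongr; exact hSk k
        _ = 8 * (∑ k, x k ^ 2 / q ^ 2) * S := by rw [← Finset.sum_mul, ← Finset.mul_sum]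
        _ ≤ 8 * 1 * S := by gcongr
        _ = 8 * S := by ring
    linarith
  calc ∫⁻ u, ENNReal.ofReal ((clippedNorm e M (x + u) - clippedNorm e M x) ^ 2) ∂ν
      ≤ ∫⁻ u, ENNReal.ofReal (F u) ∂ν := lintegral_mono_ae <| by
        filter_upwards [hpt] with u hu
        exact ENNReal.ofReal_le_ofReal hu
    _ = ENNReal.ofReal (∫ u, F u ∂ν) := (ofReal_integral_eq_lintegral_ofReal hFi
        (.of_forall fun u => Finset.sum_nonneg fun k _ => by positivity)).symm
    _ ≤ _ := ENNReal.ofReal_le_ofReal hFint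

/-- If every axial second moment vanished, almost every jump would be zero, contradicting `ν ≠ 0`.
-/
theorem IsLevyMeasure.varianceFactor_pos (hν : IsLevyMeasure ν) (hν0 : ν ≠ 0) {R : ℝ}
    (hax : ∀ᵐ u ∂ν, ∀ i j, i ≠ j → u i = 0 ∨ u j = 0)
    (hb : ∀ᵐ u ∂ν, ‖u‖ ≤ R) (ε m : ℝ) : 0 < varianceFactor ν ε m := by
  have hk : ∃ k, 0 < ∫ y, y ^ 2 ∂(axisLevyMeasure ν k) := by
    by_contra! h
    refine hν0 (hν.eq_zero_of_coord fun k => ?_)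
    have h0 : ∫ u, u k ^ 2 ∂ν = 0 := by
      rw [← integral_axis hax k (f := fun y => y ^ 2) (by fun_prop) (by simp)]
      exact le_antisymm (h k) (integral_nonneg fun y => sq_nonneg _)
    have := (integral_eq_zero_iff_of_nonneg (fun u => sq_nonneg _)
      (hν.integrable_sq_coord hb k)).1 h0
    filter_upwards [this] with u hu
    exact pow_eq_zero_iff two_ne_zero |>.1 hu
  obtain ⟨k, hk⟩ := hk
  have h1 : 0 < ⨆ k, ∫ y, y ^ 2 ∂(axisLevyMeasure ν k) :=
    hk.trans_le (le_ciSup (f := fun k => ∫ y, y ^ 2 ∂(axisLevyMeasure ν k))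
      (Set.finite_range _).bddAbove k)
  have h2 : 0 ≤ 2 / (ε * m) ^ 2 * ∑ k, ∫ u, u ^ 4 ∂(axisLevyMeasure ν k) :=
    mul_nonneg (by positivity) (Finset.sum_nonneg fun k _ => integral_nonneg fun y => by positivity)
  rw [varianceFactor]
  linarith

end Moments

/-! ### Chernoff's inequality and the conclusion. -/

/-- The Chernoff bound optimised for Poisson-type exponential moments. -/
theorem measureReal_ge_le_bennett {Ω : Type*} [MeasurableSpace Ω] {P : Measure Ω}
    [IsFiniteMeasure P] {Y : Ω → ℝ} (hY : Measurable Y) {C : ℝ} (hC : ∀ ω, |Y ω| ≤ C)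
    {m R V : ℝ} (hR : 0 < R) (hV : 0 < V)
    (hexp : ∀ l : ℝ, 0 ≤ l → ∫ ω, Real.exp (l * Y ω) ∂P ≤
      Real.exp (l * m + V * ((Real.exp (l * R) - 1 - l * R) / R ^ 2))) {x : ℝ} (hx : 0 ≤ x) :
    P.real {ω | m + x ≤ Y ω} ≤
      Real.exp (x / R - (x / R + V / R ^ 2) * Real.log (1 + R * x / V)) := by
  have hpos : 0 < 1 + R * x / V := by positivity
  -- The minimiser of `V (exp (l R) - 1 - l R) / R² - l x`, where `exp (l R) = 1 + R x / V`.
  set l := Real.log (1 + R * x / V) / R with hl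
  have hl0 : 0 ≤ l := div_nonneg (Real.log_nonneg (by
    have : 0 ≤ R * x / V := by positivity
    linarith)) hR.le
  have hint : Integrable (fun ω => Real.exp (l * Y ω)) P :=
    integrable_of_abs_le (C := Real.exp (l * C)) (by fun_prop) fun ω => by
      rw [Real.abs_exp]; gcongr; exact (le_abs_self _).trans (hC _)
  refine (measure_ge_le_exp_mul_mgf (m + x) hl0 hint).trans ?_
  have hlR : l * R = Real.log (1 + R * x / V) := by rw [hl]; field_simp
  refine (mul_le_mul_of_nonneg_left (hexp l hl0) (Real.exp_pos _).le).trans_eq ?_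
  rw [← Real.exp_add, hlR, Real.exp_log hpos, ← hlR]
  congr 1
  field_simp
  ring

theorem corollary2 {d : ℕ} {Ω : Type*} [MeasurableSpace Ω] (P : Measure Ω)
    [IsProbabilityMeasure P] (X : Ω → EuclideanSpace ℝ (Fin d))
    (γ : EuclideanSpace ℝ (Fin d)) (ν : Measure (EuclideanSpace ℝ (Fin d)))
    (hν : ν ≠ 0) (hX : IsIDVector X γ ν P)
    (hindep : iIndepFun (fun (k : Fin d) (ω : Ω) => X ω k) P)
    (hR : ∀ k, supportRadius (axisLevyMeasure ν k) ≠ ∞)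
    (ε : ℝ) (hε : 0 < ε) :
    -- the quantities in the bound are finite, and `𝔼‖X‖₂` is positive
    (Integrable (fun ω => ‖X ω‖) P ∧ 0 < ∫ ω, ‖X ω‖ ∂P ∧
      ∀ k, Integrable (fun u : ℝ => u ^ 2) (axisLevyMeasure ν k) ∧
        Integrable (fun u : ℝ => u ^ 4) (axisLevyMeasure ν k)) ∧
    -- the Bennett-type bound
    ∀ R Vsq : ℝ, R = maxRadius ν → Vsq = varianceFactor ν ε (∫ ω, ‖X ω‖ ∂P) →
      ∀ x : ℝ, 0 ≤ x →
        P.real {ω | (1 + ε) * (∫ ω', ‖X ω'‖ ∂P) + x ≤ ‖X ω‖} ≤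
          Real.exp (x / R - (x / R + Vsq / R ^ 2) * Real.log (1 + R * x / Vsq)) := by
  have hL := hX.isLevyMeasure
  have hXm := hX.measurable
  have hax := hX.ae_eq_zero_or_eq_zero hindep
  have hs := ae_exists_eq_single hL.ae_ne_zero hax hR
  have hb : ∀ᵐ u ∂ν, ‖u‖ ≤ maxRadius ν := by
    filter_upwards [hs] with u ⟨k, v, _, hv, hu⟩
    rwa [hu, PiLp.norm_single]
  have hR0 : 0 < maxRadius ν := by
    by_contra! h
    refine hν (hL.eq_zero_of_ae_eq_zero ?_)
    filter_upwards [hb] with u hu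
    exact norm_le_zero_iff.1 (hu.trans h)
  have hint := hX.integrable_norm hR0 hb
  have hm : 0 < ∫ ω, ‖X ω‖ ∂P := by
    refine lt_of_le_of_ne (integral_nonneg fun ω => norm_nonneg _) fun h0 => hν ?_
    refine hX.eq_zero_of_ae_eq_zero ?_
    filter_upwards [(integral_eq_zero_iff_of_nonneg (fun ω => norm_nonneg _) hint).1 h0.symm]
      with ω hω
    exact norm_eq_zero.1 hω
  refine ⟨⟨hint, hm, fun k => ⟨?_, ?_⟩⟩, ?_⟩
  · exact (integrable_axis_iff (by fun_prop)).2 (hL.integrable_sq_coord hb k).integrableOn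
  · exact (integrable_axis_iff (by fun_prop)).2 (hL.integrable_four_coord hb k).integrableOn
  rintro R V rfl rfl x hx
  set m := ∫ ω, ‖X ω‖ ∂P with hm'
  have he : 0 < ε * m := mul_pos hε hm
  have hV := hL.varianceFactor_pos hν hax hb ε m
  have hM : 0 ≤ (1 + ε) * m + x := by positivity
  -- The ceiling is the deviation threshold itself: `g` becomes bounded, yet still reaches the
  -- threshold whenever `‖X‖` does.
  set g : EuclideanSpace ℝ (Fin d) → ℝ := clippedNorm (ε * m) ((1 + ε) * m + x) with hg
  have hgc : Continuous g := continuous_clippedNorm _ _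
  have hgb : ∀ y, |g y| ≤ (1 + ε) * m + x := abs_clippedNorm_le hM
  have hmean : ∫ ω, g (X ω) ∂P ≤ (1 + ε) * m := by
    calc ∫ ω, g (X ω) ∂P ≤ ∫ ω, (‖X ω‖ + ε * m) ∂P := by
          refine integral_mono (integrable_of_abs_le (by fun_prop) fun ω => hgb _)
            (hint.add (integrable_const _)) fun ω => ?_
          exact (min_le_left _ _).trans (max_le_add_of_nonneg (norm_nonneg _) he.le)
      _ = (1 + ε) * m := by
          rw [integral_add hint (integrable_const _)]
          simp
          ring
  have key := measureReal_ge_le_bennett (P := P) (Y := fun ω => g (X ω)) (m := (1 + ε) * m)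
    (by fun_prop) (fun ω => hgb _) hR0 hV (fun l hl => ?_) hx
  · refine (measureReal_mono fun ω (hω : (1 + ε) * m + x ≤ ‖X ω‖) => ?_).trans key
    exact le_min (le_max_of_le_left hω) le_rfl
  · have hincr := hL.incrBound_clippedNorm hax
      (hs.mono fun u ⟨k, v, _, _, hu⟩ => ⟨k, v, hu⟩) hb he hM
    refine (hX.integral_exp_le hR0 hV.le hgc hincr hl).trans ?_
    -- As `l ≥ 0`, the mean of `g(X)` may be replaced by its upper bound `(1 + ε) m`.
    gcongr
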